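/- **Complexity of uniform sampling.** Let $n,d,m\ge 1$, let $f_1,\dots,f_n:\mathbb{R}^d\to\mathbb{R}$ be twice differentiable, and let $F=\frac1n\sum_{i=1}^n f_i$. Suppose that $\sup_{y\in\mathbb{R}^d}\|\nabla^2 f_i(y)\|\le K_i$ for $i=1,\dots,n$, where $\|\cdot\|$ is the spectral norm, and put $K_{\max}=\max_{1\le i\le n}K_i$. Let $0<\varepsilon,\delta<1$ and let $$m\ \ge\ \frac{16K_{\max}^2}{\varepsilon^2}\,\log\frac{2d}{\delta}.$$ Let the sample $\mathcal S=(j_1,\dots,j_m)$ be drawn uniformly at random from $\{1,\dots,n\}$, either with replacement ($j_1,\dots,j_m$ are independent and uniformly distributed) or without replacement ($m\le n$, and $(j_1,\dots,j_m)$ is uniformly distributed over the $m$-tuples of pairwise distinct indices). Fix any $x\in\mathbb{R}^d$ and form the sub-sampled Hessian $$H(x)=\frac{1}{nm}\sum_{k=1}^m\frac{1}{p_{j_k}}\nabla^2 f_{j_k}(x),\qquad p_i=\frac1n\ \text{ for all } i,$$ that is, $H(x)=\frac1m\sum_{k=1}^m\nabla^2 f_{j_k}(x)$. Then $$\Pr\big(\|H(x)-\nabla^2F(x)\|\le\varepsilon\big)\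 \ge\ 1-\delta .$$ -/

import Mathlib

open MeasureTheory ProbabilityTheory

noncomputable section

namespace SubsampledNewton

/-- `f` is differentiable everywhere and so is its gradient (continuity of the second derivative
is not required). -/
def TwiceDifferentiable {d : ℕ} (f : EuclideanSpace ℝ (Fin d) → ℝ) : Prop :=
  Differentiable ℝ f ∧ Differentiable ℝ (gradient f)

/-- The Hessian of `f` at `x`, as the linear operator on Euclidean space given by the derivative of
the gradient. Its operator norm is the spectral norm of the matrix of second partial derivatives. -/
def hessian {d : ℕ} (f : EuclideanSpace ℝ (Fin d) → ℝ) (x : EuclideanSpace ℝ (Fin d)) :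
    EuclideanSpace ℝ (Fin d) →L[ℝ] EuclideanSpace ℝ (Fin d) :=
  fderiv ℝ (gradient f) x

/-- The finite-sum objective `F = (1 / n) ∑ i, f i`. -/
def finiteSum {d n : ℕ} (f : Fin n → EuclideanSpace ℝ (Fin d) → ℝ) :
    EuclideanSpace ℝ (Fin d) → ℝ :=
  fun x => (1 / (n : ℝ)) * ∑ i, f i x

/-- The sub-sampled Hessian `(1 / (n m)) ∑ j ∈ S, (1 / p j) ∇² f j (x)`, where the sample
collection `S` is listed, with multiplicity, by `s : Fin m → Fin n`. -/
def subsampledHessian {d n m : ℕ} (f : Fin n → EuclideanSpace ℝ (Fin d) → ℝ) (p : Fin n → ℝ)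
    (s : Fin m → Fin n) (x : EuclideanSpace ℝ (Fin d)) :
    EuclideanSpace ℝ (Fin d) →L[ℝ] EuclideanSpace ℝ (Fin d) :=
  (1 / ((n : ℝ) * (m : ℝ))) • ∑ k, (1 / p (s k)) • hessian (f (s k)) x

/-- `J 0, …, J (m - 1)` are independent and each is uniform on the `n` indices. -/
def UniformWithReplacement {Ω : Type*} [MeasurableSpace Ω] (μ : Measure Ω) {n m : ℕ}
    (J : Fin m → Ω → Fin n) : Prop :=
  iIndepFun J μ ∧ ∀ k, HasLaw (J k) (uniformOn Set.univ) μ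

/-- `(J 0, …, J (m - 1))` is uniform on the `m`-tuples of pairwise distinct indices. -/
def UniformWithoutReplacement {Ω : Type*} [MeasurableSpace Ω] (μ : Measure Ω) {n m : ℕ}
    (J : Fin m → Ω → Fin n) : Prop :=
  HasLaw (fun ω k => J k ω) (uniformOn {s : Fin m → Fin n | Function.Injective s}) μ

end SubsampledNewton

end

/-!
With `X i = ∇² f i (x) - ∇² F (x)`, the claim is that the norm of `S = ∑ k, X (J k)` exceeds `m ε` with
probability at most `δ`. The `X i` are symmetric, they sum to zero, and `‖X i - X j‖ ≤ 2 Kmax`. The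
proof is the method of exchangeable pairs; it needs neither matrix exponentials nor the
Golden-Thompson or Lieb inequalities, and it treats both sampling schemes alike.

Let `φ θ` be the expectation of `tr cosh (θ S)`, so that `φ' θ` is that of `tr S sinh (θ S)`. Move from
a sample `s` to a sample `s'` by replacing one drawn index by a uniform index `i` (with replacement,
`resample`), or by exchanging a drawn index with `i` (without replacement, `exchangeIndices`). These
moves are reversible, each changes `S` by at most `L = 2 Kmax` in norm, and since `∑ i, X i = 0` the
sum of `S - S'` over the `n m` moves is `n S` (`sum_sub_sum_resample`, `sum_sub_sum_exchangeIndices`).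
By reversibility `φ'` is therefore `m / 2` times the mean of
`tr (S - S') (sinh (θ S) - sinh (θ S'))` over a random sample and a random move.

The mean value trace inequality (`sum_sinh_mul_inner_sub_le`) bounds such a trace by
`θ/2 * ‖S - S'‖² * tr (cosh (θ S) + cosh (θ S'))`. It reduces to a scalar inequality for `sinh` when the
traces are expanded in eigenbases of `S` and `S'`; all traces here are written as sums over
eigenvalues. Hence `φ' ≤ θ L² m / 2 * φ` (`sum_eigenvalue_mul_sinh_le`), so
`φ θ ≤ d exp (θ² L² m / 4)` (`sum_cosh_eigenvalue_le`), and Markov's inequality bounds the probability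
that `‖S‖ > r` by `2 d exp (-r² / (L² m))` (`card_filter_lt_norm_le`). For `r = m ε` this is
`2 d exp (-ε² m / (4 Kmax²))`, which is at most `δ` under the size condition.
-/

namespace MatrixConcentration

/-! ### A mean value inequality for the hyperbolic sine -/

theorem sinh_le_mul_cosh {h : ℝ} (hh : 0 ≤ h) : Real.sinh h ≤ h * Real.cosh h := by
  have hmono : MonotoneOn (fun x : ℝ => x * Real.cosh x - Real.sinh x) (Set.Ici 0) := by
    apply monotoneOn_of_deriv_nonneg (convex_Ici 0)
    · fun_prop
    · fun_prop
    · intro x hx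
      rw [interior_Ici] at hx
      have : HasDerivAt (fun x : ℝ => x * Real.cosh x - Real.sinh x)
          (1 * Real.cosh x + x * Real.sinh x - Real.cosh x) x :=
        ((hasDerivAt_id x).mul (Real.hasDerivAt_cosh x)).sub (Real.hasDerivAt_sinh x)
      rw [this.deriv]
      have := Real.sinh_nonneg_iff.2 (le_of_lt hx)
      have hx' : 0 ≤ x := le_of_lt hx
      nlinarith [mul_nonneg hx' this]
  have := hmono (Set.self_mem_Ici) hh hh
  simpa using this

theorem mul_sinh_le_sq_mul_cosh (h : ℝ) : h * Real.sinh h ≤ h ^ 2 * Real.cosh h := by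
  rcases le_total 0 h with hh | hh
  · nlinarith [mul_le_mul_of_nonneg_left (sinh_le_mul_cosh hh) hh]
  · have h1 := sinh_le_mul_cosh (neg_nonneg.2 hh)
    rw [Real.sinh_neg, Real.cosh_neg] at h1
    nlinarith [mul_le_mul_of_nonneg_left h1 (neg_nonneg.2 hh)]

/-- The scalar mean value inequality: the slope of `sinh` between two points is at most the mean of
its derivative at the two points. -/
theorem sub_mul_sinh_sub_sinh_le (x y : ℝ) :
    (x - y) * (Real.sinh x - Real.sinh y) ≤
      (x - y) ^ 2 / 2 * (Real.cosh x + Real.cosh y) := by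
  obtain ⟨p, h, rfl, rfl⟩ : ∃ p h : ℝ, x = p + h ∧ y = p - h :=
    ⟨(x + y) / 2, (x - y) / 2, by ring, by ring⟩
  have key := mul_le_mul_of_nonneg_left (mul_sinh_le_sq_mul_cosh h) (Real.cosh_pos p).le
  rw [Real.sinh_add, Real.sinh_sub, Real.cosh_add, Real.cosh_sub]
  linarith

/-! ### Eigenbases of two symmetric operators -/

section Eigenbasis

variable {E ι : Type*} [NormedAddCommGroup E] [InnerProductSpace ℝ E] [Fintype ι]

theorem inner_sub_apply_eigenvector {A B : E →L[ℝ] E} (hB : (B : E →ₗ[ℝ] E).IsSymmetric)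
    {u v : E} {a b : ℝ} (hu : A u = a • u) (hv : B v = b • v) :
    inner ℝ ((A - B) u) v = (a - b) * inner ℝ u v := by
  have h : inner ℝ (B u) v = inner ℝ u (B v) := hB u v
  rw [sub_apply, inner_sub_left, h, hu, hv, real_inner_smul_left,
    real_inner_smul_right]
  ring

/-- If `u` is an eigenvector of `A`, the quadratic form of `A - B` at `u` is a weighted sum of
eigenvalue differences, with the squared overlaps of `u` and the eigenbasis of `B` as weights. -/
theorem inner_sub_apply_self_eq_sum {A B : E →L[ℝ] E} (hB : (B : E →ₗ[ℝ] E).IsSymmetric)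
    (v : OrthonormalBasis ι ℝ E) {b : ι → ℝ} (hv : ∀ j, B (v j) = b j • v j)
    {u : E} {a : ℝ} (hu : A u = a • u) :
    inner ℝ ((A - B) u) u = ∑ j, (a - b j) * inner ℝ u (v j) ^ 2 := by
  rw [← v.sum_inner_mul_inner]
  refine Finset.sum_congr rfl fun j _ => ?_
  rw [inner_sub_apply_eigenvector hB hu (hv j), real_inner_comm u (v j)]
  ring

theorem norm_sub_apply_sq_eq_sum {A B : E →L[ℝ] E} (hB : (B : E →ₗ[ℝ] E).IsSymmetric)
    (v : OrthonormalBasis ι ℝ E) {b : ι → ℝ} (hv : ∀ j, B (v j) = b j • v j)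
    {u : E} {a : ℝ} (hu : A u = a • u) :
    ‖(A - B) u‖ ^ 2 = ∑ j, (a - b j) ^ 2 * inner ℝ u (v j) ^ 2 := by
  rw [← real_inner_self_eq_norm_sq, ← v.sum_inner_mul_inner]
  refine Finset.sum_congr rfl fun j _ => ?_
  rw [real_inner_comm ((A - B) u) (v j), inner_sub_apply_eigenvector hB hu (hv j)]
  ring

theorem sum_mul_norm_apply_sq_le (D : E →L[ℝ] E) (u : OrthonormalBasis ι ℝ E) (c : ι → ℝ)
    (hc : ∀ i, 0 ≤ c i) : ∑ i, c i * ‖D (u i)‖ ^ 2 ≤ ‖D‖ ^ 2 * ∑ i, c i := by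
  rw [Finset.mul_sum]
  refine Finset.sum_le_sum fun i _ => ?_
  have h : ‖D (u i)‖ ≤ ‖D‖ := by
    simpa using D.le_opNorm (u i)
  rw [mul_comm]
  exact mul_le_mul_of_nonneg_right (pow_le_pow_left₀ (norm_nonneg _) h 2) (hc i)

/-- The mean value trace inequality
`tr (A - B) (sinh θA - sinh θB) ≤ θ/2 * ‖A - B‖² * tr (cosh θA + cosh θB)`, with the traces written
out in eigenbases. With the weights `⟪u i, v j⟫²` both sides become double sums over pairs of
eigenvalues, which are compared term by term through the scalar inequality. -/
theorem sum_sinh_mul_inner_sub_le {A B : E →L[ℝ] E}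
    (hA : (A : E →ₗ[ℝ] E).IsSymmetric) (hB : (B : E →ₗ[ℝ] E).IsSymmetric)
    (u v : OrthonormalBasis ι ℝ E) {a b : ι → ℝ}
    (hu : ∀ i, A (u i) = a i • u i) (hv : ∀ j, B (v j) = b j • v j) {θ : ℝ} (hθ : 0 < θ) :
    ∑ i, Real.sinh (θ * a i) * inner ℝ ((A - B) (u i)) (u i) +
        ∑ j, Real.sinh (θ * b j) * inner ℝ ((B - A) (v j)) (v j) ≤
      θ / 2 * ‖A - B‖ ^ 2 * (∑ i, Real.cosh (θ * a i) + ∑ j, Real.cosh (θ * b j)) := by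
  have h1 := sum_mul_norm_apply_sq_le (A - B) u (fun i => Real.cosh (θ * a i))
    fun i => (Real.cosh_pos _).le
  have h2 := sum_mul_norm_apply_sq_le (B - A) v (fun j => Real.cosh (θ * b j))
    fun j => (Real.cosh_pos _).le
  rw [norm_sub_rev B A] at h2
  simp_rw [norm_sub_apply_sq_eq_sum hB v hv (hu _), Finset.mul_sum] at h1
  simp_rw [norm_sub_apply_sq_eq_sum hA u hu (hv _), Finset.mul_sum] at h2
  simp_rw [inner_sub_apply_self_eq_sum hB v hv (hu _),
    inner_sub_apply_self_eq_sum hA u hu (hv _), Finset.mul_sum]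
  rw [Finset.sum_comm] at h2
  rw [Finset.sum_comm (f := fun j i => Real.sinh (θ * b j) * _)]
  have key : ∀ i j, Real.sinh (θ * a i) * ((a i - b j) * inner ℝ (u i) (v j) ^ 2) +
      Real.sinh (θ * b j) * ((b j - a i) * inner ℝ (v j) (u i) ^ 2) ≤
      θ / 2 * (Real.cosh (θ * a i) * ((a i - b j) ^ 2 * inner ℝ (u i) (v j) ^ 2) +
      Real.cosh (θ * b j) * ((b j - a i) ^ 2 * inner ℝ (v j) (u i) ^ 2)) := by
    intro i j
    have h := sub_mul_sinh_sub_sinh_le (θ * a i) (θ * b j)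
    have h' : (a i - b j) * (Real.sinh (θ * a i) - Real.sinh (θ * b j)) ≤
        θ / 2 * (a i - b j) ^ 2 * (Real.cosh (θ * a i) + Real.cosh (θ * b j)) := by
      refine le_of_mul_le_mul_left ?_ hθ
      linarith
    rw [real_inner_comm (u i) (v j)]
    linarith [mul_le_mul_of_nonneg_right h' (sq_nonneg (inner ℝ (u i) (v j)))]
  have hs := Finset.sum_le_sum fun i (_ : i ∈ Finset.univ) =>
    Finset.sum_le_sum fun j (_ : j ∈ Finset.univ) => key i j
  have h1' := mul_le_mul_of_nonneg_left h1 (half_pos hθ).le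
  have h2' := mul_le_mul_of_nonneg_left h2 (half_pos hθ).le
  simp only [Finset.mul_sum, mul_add, Finset.sum_add_distrib, mul_assoc] at hs h1' h2' ⊢
  linarith

theorem isSymmetric_sum {T : ι → E →L[ℝ] E}
    (hT : ∀ k, (T k : E →ₗ[ℝ] E).IsSymmetric) :
    ((∑ k, T k : E →L[ℝ] E) : E →ₗ[ℝ] E).IsSymmetric := by
  rw [ContinuousLinearMap.toLinearMap_sum]
  exact LinearMap.isSymmetric_sum _ fun k _ => hT k

theorem norm_le_of_abs_eigenvalue_le {A : E →L[ℝ] E} (hA : (A : E →ₗ[ℝ] E).IsSymmetric)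
    (u : OrthonormalBasis ι ℝ E) {a : ι → ℝ} (hu : ∀ i, A (u i) = a i • u i) {r : ℝ}
    (hr : 0 ≤ r) (ha : ∀ i, |a i| ≤ r) : ‖A‖ ≤ r := by
  refine A.opNorm_le_bound hr fun x => ?_
  refine le_of_sq_le_sq ?_ (by positivity)
  rw [mul_pow, ← u.sum_sq_norm_inner_right, ← u.sum_sq_norm_inner_right, Finset.mul_sum]
  refine Finset.sum_le_sum fun i _ => ?_
  have h : inner ℝ (u i) (A x) = a i * inner ℝ (u i) x := by
    have : inner ℝ (A (u i)) x = inner ℝ (u i) (A x) := hA _ _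
    rw [← this, hu, real_inner_smul_left]
  rw [h, norm_mul, mul_pow]
  gcongr
  exact ha i

end Eigenbasis

/-! ### Exponential moments of a reversible family of operators -/

/-- A reversible system of moves on the finite set `A`: from each state `t` there is one move for
each label `c : C`, and the move `step t c` is undone by the move with label `back t c`. Thus
`(t, c) ↦ (step t c, back t c)` is an involution of `A × C`, so that for `t` uniform on `A` and
`c` uniform on `C` the pair `(t, step t c)` is exchangeable. -/
structure ReversibleMoves {τ : Type*} (A : Finset τ) (C : Type*) where
  /-- the state reached from a state by the move with a given label -/
  step : τ → C → τ
  /-- the label of the reverse move -/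
  back : τ → C → C
  step_mem : ∀ t ∈ A, ∀ c, step t c ∈ A
  step_back : ∀ t ∈ A, ∀ c, step (step t c) (back t c) = t
  back_back : ∀ t ∈ A, ∀ c, back (step t c) (back t c) = c

section Moments

variable {E ι τ C : Type*} [NormedAddCommGroup E] [InnerProductSpace ℝ E] [Fintype ι] [Fintype C]
  {A : Finset τ}

/-- Exchangeability: a sum over all moves is unchanged if every move is reversed. -/
theorem ReversibleMoves.sum_step (R : ReversibleMoves A C) (F : τ → τ → ℝ) :
    ∑ t ∈ A, ∑ c, F t (R.step t c) = ∑ t ∈ A, ∑ c, F (R.step t c) t := by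
  rw [← Finset.sum_product', ← Finset.sum_product']
  refine Finset.sum_nbij' (fun p => (R.step p.1 p.2, R.back p.1 p.2))
    (fun p => (R.step p.1 p.2, R.back p.1 p.2)) ?_ ?_ ?_ ?_ ?_
  · intro p hp
    simpa using R.step_mem p.1 (by simpa using hp) p.2
  · intro p hp
    simpa using R.step_mem p.1 (by simpa using hp) p.2
  · intro p hp
    have h : p.1 ∈ A := by simpa using hp
    exact Prod.ext (R.step_back _ h _) (R.back_back _ h _)
  · intro p hp
    have h : p.1 ∈ A := by simpa using hp
    exact Prod.ext (R.step_back _ h _) (R.back_back _ h _)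
  · intro p hp
    have h : p.1 ∈ A := by simpa using hp
    simp only [R.step_back _ h]

/-- The differential inequality behind the concentration bound: the derivative in `θ` of the sum of
`tr cosh (θ S t)` is at most a multiple of `θ` times this sum. By the drift hypothesis, `N` times
the derivative is the sum of `tr (S t - S t') sinh (θ S t)` over all moves `t → t'`; by
exchangeability this is half the sum of `tr (S t - S t') (sinh (θ S t) - sinh (θ S t'))`, to which
the mean value trace inequality applies. -/
theorem sum_eigenvalue_mul_sinh_le (R : ReversibleMoves A C) {S : τ → E →L[ℝ] E}
    (hS : ∀ t, (S t : E →ₗ[ℝ] E).IsSymmetric) (u : τ → OrthonormalBasis ι ℝ E) {a : τ → ι → ℝ}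
    (hu : ∀ t i, S t (u t i) = a t i • u t i) {N L v : ℝ} (hN : 0 < N)
    (hdrift : ∀ t ∈ A, ∑ c, (S t - S (R.step t c)) = N • S t)
    (hL : ∀ t ∈ A, ∀ c, ‖S t - S (R.step t c)‖ ≤ L) (hcard : (Fintype.card C : ℝ) ≤ N * v)
    {θ : ℝ} (hθ : 0 < θ) :
    ∑ t ∈ A, ∑ i, a t i * Real.sinh (θ * a t i) ≤
      θ * L ^ 2 * v / 2 * ∑ t ∈ A, ∑ i, Real.cosh (θ * a t i) := by
  set Z : τ → ℝ := fun t => ∑ i, Real.cosh (θ * a t i) with hZ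
  have hZ0 : ∀ t, 0 ≤ Z t := fun t => Finset.sum_nonneg fun i _ => (Real.cosh_pos _).le
  set G : τ → τ → ℝ := fun t t' =>
    ∑ i, Real.sinh (θ * a t i) * inner ℝ ((S t - S t') (u t i)) (u t i) with hG
  have hself : ∀ t ∈ A, ∑ c, G t (R.step t c) = N * ∑ i, a t i * Real.sinh (θ * a t i) := by
    intro t ht
    simp only [hG]
    rw [Finset.sum_comm, Finset.mul_sum]
    refine Finset.sum_congr rfl fun i _ => ?_
    rw [← Finset.mul_sum, ← sum_inner, ← sum_apply, hdrift t ht,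
      smul_apply, hu, smul_smul, real_inner_smul_left,
      real_inner_self_eq_norm_sq, (u t).norm_eq_one]
    ring
  have hpair : ∀ t ∈ A, ∀ c, G t (R.step t c) + G (R.step t c) t ≤
      θ / 2 * L ^ 2 * (Z t + Z (R.step t c)) := by
    intro t ht c
    refine (sum_sinh_mul_inner_sub_le (hS t) (hS _) (u t) (u _) (hu t) (hu _) hθ).trans ?_
    have h := pow_le_pow_left₀ (norm_nonneg _) (hL t ht c) 2
    have h0 := add_nonneg (hZ0 t) (hZ0 (R.step t c))
    gcongr
  have hG2 := R.sum_step G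
  have hZ2 := R.sum_step fun t _ => Z t
  have hsum := Finset.sum_le_sum fun t (ht : t ∈ A) =>
    Finset.sum_le_sum fun c (_ : c ∈ Finset.univ) => hpair t ht c
  simp only [Finset.sum_add_distrib, ← Finset.mul_sum] at hsum
  rw [← hG2, ← hZ2, Finset.sum_congr rfl hself, ← Finset.mul_sum] at hsum
  simp only [Finset.sum_const, Finset.card_univ, nsmul_eq_mul] at hsum
  rw [← Finset.mul_sum] at hsum
  have hc := mul_le_mul_of_nonneg_right hcard
    (mul_nonneg (mul_nonneg hθ.le (sq_nonneg L)) (Finset.sum_nonneg fun t (_ : t ∈ A) => hZ0 t))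
  refine le_of_mul_le_mul_left ?_ hN
  linarith

/-- The differential inequality integrated: `φ θ * exp (-w θ²)` is nonincreasing on `[0, ∞)`. -/
theorem sum_cosh_eigenvalue_le (R : ReversibleMoves A C) {S : τ → E →L[ℝ] E}
    (hS : ∀ t, (S t : E →ₗ[ℝ] E).IsSymmetric) (u : τ → OrthonormalBasis ι ℝ E) {a : τ → ι → ℝ}
    (hu : ∀ t i, S t (u t i) = a t i • u t i) {N L v : ℝ} (hN : 0 < N)
    (hdrift : ∀ t ∈ A, ∑ c, (S t - S (R.step t c)) = N • S t)
    (hL : ∀ t ∈ A, ∀ c, ‖S t - S (R.step t c)‖ ≤ L) (hcard : (Fintype.card C : ℝ) ≤ N * v)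
    {θ : ℝ} (hθ : 0 ≤ θ) :
    ∑ t ∈ A, ∑ i, Real.cosh (θ * a t i) ≤
      A.card * Fintype.card ι * Real.exp (L ^ 2 * v / 4 * θ ^ 2) := by
  set w : ℝ := L ^ 2 * v / 4 with hw
  set φ : ℝ → ℝ := fun s => ∑ t ∈ A, ∑ i, Real.cosh (s * a t i) with hφ
  have hφ' : ∀ s, HasDerivAt φ (∑ t ∈ A, ∑ i, a t i * Real.sinh (s * a t i)) s := by
    intro s
    refine HasDerivAt.fun_sum fun t _ => HasDerivAt.fun_sum fun i _ => ?_
    have := (hasDerivAt_mul_const (a t i) (x := s)).cosh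
    rwa [mul_comm] at this
  have hψ' : ∀ s, HasDerivAt (fun s => φ s * Real.exp (-(w * s ^ 2)))
      ((∑ t ∈ A, ∑ i, a t i * Real.sinh (s * a t i)) * Real.exp (-(w * s ^ 2)) +
        φ s * (Real.exp (-(w * s ^ 2)) * -(w * (2 * s)))) s := by
    intro s
    have h : HasDerivAt (fun s : ℝ => -(w * s ^ 2)) (-(w * (2 * s))) s := by
      simpa using ((hasDerivAt_pow 2 s).const_mul w).fun_neg
    exact (hφ' s).mul h.exp
  have hanti : AntitoneOn (fun s => φ s * Real.exp (-(w * s ^ 2))) (Set.Ici 0) := by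
    refine antitoneOn_of_deriv_nonpos (convex_Ici 0)
      (fun s _ => (hψ' s).continuousAt.continuousWithinAt)
      (fun s _ => (hψ' s).differentiableAt.differentiableWithinAt) fun s hs => ?_
    rw [interior_Ici] at hs
    rw [(hψ' s).deriv]
    have h := mul_le_mul_of_nonneg_right
      (sum_eigenvalue_mul_sinh_le R hS u hu hN hdrift hL hcard hs) (Real.exp_pos (-(w * s ^ 2))).le
    simp only [hφ, hw] at h ⊢
    linarith
  have h := hanti Set.self_mem_Ici hθ hθ
  simp only [hφ, zero_mul, Real.cosh_zero, Finset.sum_const, Finset.card_univ, nsmul_eq_mul,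
    mul_one, ne_eq, OfNat.ofNat_ne_zero, not_false_eq_true, zero_pow, mul_zero, neg_zero,
    Real.exp_zero] at h
  rwa [Real.exp_neg, ← div_eq_mul_inv, div_le_iff₀ (Real.exp_pos _)] at h

/-- Concentration of the norm along a reversible system of moves, from the moment bound by Markov's
inequality. A state with `r < ‖S t‖` has an eigenvalue of modulus larger than `r`, of either sign;
`cosh` handles both signs at once and costs the factor `2`. -/
theorem card_filter_lt_norm_le [FiniteDimensional ℝ E]
    (R : ReversibleMoves A C) {S : τ → E →L[ℝ] E}
    (hS : ∀ t, (S t : E →ₗ[ℝ] E).IsSymmetric) {N L v : ℝ} (hN : 0 < N)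
    (hdrift : ∀ t ∈ A, ∑ c, (S t - S (R.step t c)) = N • S t)
    (hL : ∀ t ∈ A, ∀ c, ‖S t - S (R.step t c)‖ ≤ L) (hcard : (Fintype.card C : ℝ) ≤ N * v)
    (hL0 : 0 < L) (hv : 0 < v) {r : ℝ} (hr : 0 ≤ r) [DecidablePred fun t => r < ‖S t‖] :
    ((A.filter fun t => r < ‖S t‖).card : ℝ) ≤
      2 * Module.finrank ℝ E * Real.exp (-(r ^ 2 / (L ^ 2 * v))) * A.card := by
  have hsum := sum_cosh_eigenvalue_le R hS (fun t => (hS t).eigenvectorBasis rfl)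
    (fun t i => (hS t).apply_eigenvectorBasis rfl i) hN hdrift hL hcard
    (θ := 2 * r / (L ^ 2 * v)) (by positivity)
  -- This choice of `θ` minimizes `L² v θ² / 4 - θ r`.
  set θ := 2 * r / (L ^ 2 * v) with hθ
  have hθ0 : 0 ≤ θ := by positivity
  have hlow : ∀ t ∈ A.filter (fun t => r < ‖S t‖), Real.exp (θ * r) / 2 ≤
      ∑ i, Real.cosh (θ * (hS t).eigenvalues rfl i) := by
    intro t ht
    obtain ⟨i, hi⟩ : ∃ i, r < |(hS t).eigenvalues rfl i| := by
      by_contra! h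
      exact (Finset.mem_filter.1 ht).2.not_ge (norm_le_of_abs_eigenvalue_le (hS t)
        ((hS t).eigenvectorBasis rfl) (fun i => (hS t).apply_eigenvectorBasis rfl i) hr h)
    refine le_trans ?_ (Finset.single_le_sum (fun i _ => (Real.cosh_pos _).le) (Finset.mem_univ i))
    rw [← Real.cosh_abs, abs_mul, abs_of_nonneg hθ0, Real.cosh_eq]
    have h1 : Real.exp (θ * r) ≤ Real.exp (θ * |(hS t).eigenvalues rfl i|) :=
      Real.exp_le_exp.2 (mul_le_mul_of_nonneg_left hi.le hθ0)
    have h2 := Real.exp_pos (-(θ * |(hS t).eigenvalues rfl i|))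
    linarith
  have h1 := Finset.card_nsmul_le_sum _ _ _ hlow
  have h2 := h1.trans ((Finset.sum_le_sum_of_subset_of_nonneg (Finset.filter_subset _ A)
    fun t _ _ => Finset.sum_nonneg fun i _ => (Real.cosh_pos _).le).trans hsum)
  rw [nsmul_eq_mul, Fintype.card_fin] at h2
  have hexp : Real.exp (L ^ 2 * v / 4 * θ ^ 2) =
      Real.exp (-(r ^ 2 / (L ^ 2 * v))) * Real.exp (θ * r) := by
    rw [← Real.exp_add, hθ]
    congr 1
    field_simp
    ring
  rw [hexp] at h2
  refine le_of_mul_le_mul_right ?_ (half_pos (Real.exp_pos (θ * r)))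
  linarith

end Moments

/-! ### Uniform samples with and without replacement -/

theorem sum_sub_sum_update {κ η V : Type*} [Fintype κ] [DecidableEq κ] [AddCommGroup V]
    (X : η → V) (s : κ → η) (a : κ) (i : η) :
    ∑ k, X (s k) - ∑ k, X (Function.update s a i k) = X (s a) - X i := by
  rw [← Finset.sum_sub_distrib, Finset.sum_eq_single a]
  · simp
  · intro k _ hk
    simp [Function.update_of_ne hk]
  · simp

section Samples

variable {κ η V : Type*} [Fintype κ] [Fintype η] [DecidableEq κ]

/-- The moves of sampling with replacement: the index drawn at position `a` is replaced by `i`, for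
all labels `(a, i)`. -/
def resample : ReversibleMoves (Finset.univ : Finset (κ → η)) (κ × η) where
  step s c := Function.update s c.1 c.2
  back s c := (c.1, s c.1)
  step_mem _ _ _ := Finset.mem_univ _
  step_back s _ c := by simp
  back_back s _ c := by simp

theorem sum_sub_sum_resample [AddCommGroup V] (X : η → V) (hX : ∑ i, X i = 0) (s : κ → η) :
    ∑ c, (∑ k, X (s k) - ∑ k, X (resample.step s c k)) = Fintype.card η • ∑ k, X (s k) := by
  simp only [resample, sum_sub_sum_update]
  rw [Fintype.sum_prod_type]
  simp [Finset.sum_sub_distrib, hX, Finset.smul_sum]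

variable [DecidableEq η]

/-- The moves of sampling without replacement: the values `s a` and `i` are exchanged, for all labels
`(a, i)`. If `i` is not in the sample it replaces `s a`; otherwise two positions are permuted. -/
def exchangeIndices :
    ReversibleMoves (Finset.univ.filter fun s : κ → η => Function.Injective s) (κ × η) where
  step s c := Equiv.swap (s c.1) c.2 ∘ s
  back s c := (c.1, s c.1)
  step_mem s hs c := by
    simpa using hs
  step_back s _ c := by
    ext k
    simp [Equiv.swap_comm c.2]
  back_back s _ c := by simp

theorem sum_sub_sum_exchangeIndices [AddCommGroup V] (X : η → V)
    (hX : ∑ i, X i = 0) {s : κ → η} (hs : Function.Injective s) :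
    ∑ c, (∑ k, X (s k) - ∑ k, X (exchangeIndices.step s c k)) =
      Fintype.card η • ∑ k, X (s k) := by
  -- The second summand is antisymmetric in `(a, k)`, so that it cancels in the double sum.
  have key : ∀ a k, ∑ i, (X (s k) - X (Equiv.swap (s a) i (s k))) =
      (if k = a then Fintype.card η • X (s k) else 0) + (X (s k) - X (s a)) := by
    intro a k
    split_ifs with h
    · subst h
      simp [Finset.sum_sub_distrib, hX]
    · rw [Finset.sum_eq_single (s k)]
      · simp
      · intro i _ hi
        rw [Equiv.swap_apply_of_ne_of_ne (fun h' => h (hs h')) hi.symm, sub_self]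
      · simp
  have h : ∀ c : κ × η, ∑ k, X (s k) - ∑ k, X (exchangeIndices.step s c k) =
      ∑ k, (X (s k) - X (Equiv.swap (s c.1) c.2 (s k))) := by
    intro c
    rw [Finset.sum_sub_distrib]
    rfl
  simp_rw [h]
  have h' : ∀ a, ∑ i, ∑ k, (X (s k) - X (Equiv.swap (s a) i (s k))) =
      ∑ k, ((if k = a then Fintype.card η • X (s k) else 0) + (X (s k) - X (s a))) := fun a =>
    Finset.sum_comm.trans (Finset.sum_congr rfl fun k _ => key a k)
  rw [Fintype.sum_prod_type]
  simp only [h']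
  simp [Finset.sum_add_distrib, Finset.sum_sub_distrib, Finset.smul_sum]

/-- An exchange either permutes the sample, which does not change the sum, or replaces one index. -/
theorem norm_sum_sub_sum_exchangeIndices_le [NormedAddCommGroup V] {X : η → V} {L : ℝ}
    (hL : ∀ i j, ‖X i - X j‖ ≤ L) {s : κ → η} (hs : Function.Injective s) (c : κ × η) :
    ‖∑ k, X (s k) - ∑ k, X (exchangeIndices.step s c k)‖ ≤ L := by
  obtain ⟨a, i⟩ := c
  by_cases h : ∃ b, s b = i
  · obtain ⟨b, rfl⟩ := h
    have : ∑ k, X (exchangeIndices.step s (a, s b) k) = ∑ k, X (s k) := by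
      rw [← Equiv.sum_comp (Equiv.swap a b) fun k => X (s k)]
      refine Finset.sum_congr rfl fun k _ => ?_
      simp only [exchangeIndices, Function.comp_apply, hs.map_swap]
    rw [this, sub_self, norm_zero]
    exact (norm_nonneg _).trans (hL (s a) (s a))
  · have : exchangeIndices.step s (a, i) = Function.update s a i := by
      ext k
      by_cases hk : k = a
      · subst hk
        simp [exchangeIndices]
      · rw [Function.update_of_ne hk]
        exact Equiv.swap_apply_of_ne_of_ne (fun h' => hk (hs h')) fun h' => h ⟨k, h'⟩
    rw [this, sum_sub_sum_update]
    exact hL _ _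

end Samples

/-! ### Concentration for random samples -/

section Probability

variable {E : Type*} [NormedAddCommGroup E] [InnerProductSpace ℝ E] [FiniteDimensional ℝ E]
  {Ω : Type*} [MeasurableSpace Ω] {μ : Measure Ω} [IsProbabilityMeasure μ]

/-- A bound on the proportion of exceptional points of `A`, as a statement about a random variable
which is uniform on `A`. -/
theorem one_sub_le_measureReal_of_card_le {τ : Type*} [MeasurableSpace τ]
    [MeasurableSingletonClass τ] [Finite τ] {A : Finset τ} {Y : Ω → τ}
    (hY : HasLaw Y (uniformOn (A : Set τ)) μ) (p : τ → Prop) [DecidablePred p] {q : ℝ}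
    (hq : 0 ≤ q) (hp : ((A.filter fun t => ¬ p t).card : ℝ) ≤ q * A.card) :
    1 - q ≤ μ.real {ω | p (Y ω)} := by
  classical
  have := (hY.isProbabilityMeasure_iff).1 inferInstance
  rw [hY.measureReal_eq (Set.toFinite _).measurableSet, ← compl_compl {t | p t},
    probReal_compl_eq_one_sub (Set.toFinite _).measurableSet]
  have hset : (A : Set τ) ∩ {t | p t}ᶜ = ((A.filter fun t => ¬ p t : Finset τ) : Set τ) := by
    ext t
    simp
  have hval : (uniformOn (A : Set τ)).real {t | p t}ᶜ =
      ((A.filter fun t => ¬ p t).card : ℝ) / A.card := by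
    rw [Measure.real, ← uniformOn_inter_self A.finite_toSet, hset, uniformOn_apply_finset,
      Finset.inter_eq_right.2 (Finset.filter_subset _ A)]
    simp
  have hle := div_le_of_le_mul₀ (Nat.cast_nonneg _) hq hp
  linarith

/-- A Hoeffding inequality for sums of symmetric operators drawn from a centred finite population,
with the same bound for both sampling schemes. -/
theorem one_sub_le_measureReal_norm_sum_le {n m : ℕ} [NeZero n] (hm : 0 < m)
    {J : Fin m → Ω → Fin n} (hJ : SubsampledNewton.UniformWithReplacement μ J ∨
      SubsampledNewton.UniformWithoutReplacement μ J)
    {X : Fin n → E →L[ℝ] E} (hX : ∀ i, (X i : E →ₗ[ℝ] E).IsSymmetric) (hX0 : ∑ i, X i = 0)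
    {L : ℝ} (hL0 : 0 < L) (hL : ∀ i j, ‖X i - X j‖ ≤ L) {r : ℝ} (hr : 0 ≤ r) :
    1 - 2 * Module.finrank ℝ E * Real.exp (-(r ^ 2 / (L ^ 2 * m))) ≤
      μ.real {ω | ‖∑ k, X (J k ω)‖ ≤ r} := by
  classical
  have hS : ∀ s : Fin m → Fin n, ((∑ k, X (s k) : E →L[ℝ] E) : E →ₗ[ℝ] E).IsSymmetric := by
    intro s
    exact isSymmetric_sum fun k => hX (s k)
  have hcard : (Fintype.card (Fin m × Fin n) : ℝ) ≤ n * m := by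
    simp [mul_comm]
  have hn : (0 : ℝ) < n := Nat.cast_pos.2 (NeZero.pos n)
  have hm' : (0 : ℝ) < m := Nat.cast_pos.2 hm
  have hq : 0 ≤ 2 * Module.finrank ℝ E * Real.exp (-(r ^ 2 / (L ^ 2 * m))) := by positivity
  rcases hJ with ⟨hind, hlaw⟩ | hlaw
  · have hY : HasLaw (fun ω k => J k ω)
        (uniformOn ((Finset.univ : Finset (Fin m → Fin n)) : Set (Fin m → Fin n))) μ := by
      have := hind.hasLaw_pi hlaw
      rwa [← uniformOn_pi, Set.pi_univ, ← Finset.coe_univ] at this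
    refine one_sub_le_measureReal_of_card_le hY (fun s => ‖∑ k, X (s k)‖ ≤ r) hq ?_
    simp only [not_le]
    refine card_filter_lt_norm_le resample hS hn (fun s _ => ?_) (fun s _ c => ?_) hcard hL0 hm' hr
    · rw [sum_sub_sum_resample X hX0, Fintype.card_fin, Nat.cast_smul_eq_nsmul]
    · simpa only [resample, sum_sub_sum_update] using hL _ _
  · have hY : HasLaw (fun ω k => J k ω) (uniformOn
        ((Finset.univ.filter fun s : Fin m → Fin n => Function.Injective s :
          Finset (Fin m → Fin n)) : Set (Fin m → Fin n))) μ := by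
      simpa [SubsampledNewton.UniformWithoutReplacement] using hlaw
    refine one_sub_le_measureReal_of_card_le hY (fun s => ‖∑ k, X (s k)‖ ≤ r) hq ?_
    simp only [not_le]
    refine card_filter_lt_norm_le exchangeIndices hS hn (fun s hs => ?_) (fun s hs c => ?_)
      hcard hL0 hm' hr
    · rw [sum_sub_sum_exchangeIndices X hX0 (Finset.mem_filter.1 hs).2, Fintype.card_fin,
        Nat.cast_smul_eq_nsmul]
    · exact norm_sum_sub_sum_exchangeIndices_le hL (Finset.mem_filter.1 hs).2 c

end Probability

end MatrixConcentration

/-! ### Hessians and the sub-sampled Hessian -/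

namespace SubsampledNewton

variable {d : ℕ}

theorem TwiceDifferentiable.isSymmetric_hessian {f : EuclideanSpace ℝ (Fin d) → ℝ}
    (hf : TwiceDifferentiable f) (x : EuclideanSpace ℝ (Fin d)) :
    (hessian f x : EuclideanSpace ℝ (Fin d) →ₗ[ℝ] EuclideanSpace ℝ (Fin d)).IsSymmetric := by
  let B := (isBoundedBilinearMap_inner (𝕜 := ℝ) (E := EuclideanSpace ℝ (Fin d))).toContinuousLinearMap
  have h1 : ∀ y, HasFDerivAt f (B (gradient f y)) y := fun y =>
    (hf.1 y).hasGradientAt.hasFDerivAt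
  have h2 : HasFDerivAt (fun y => B (gradient f y)) (B.comp (hessian f x)) x :=
    B.hasFDerivAt.comp x (hf.2 x).hasFDerivAt
  intro v w
  have h3 : inner ℝ (hessian f x v) w = inner ℝ (hessian f x w) v :=
    second_derivative_symmetric h1 h2 v w
  exact h3.trans (real_inner_comm _ _)

theorem hessian_finiteSum {n : ℕ} {f : Fin n → EuclideanSpace ℝ (Fin d) → ℝ}
    (hf : ∀ i, TwiceDifferentiable (f i)) (x : EuclideanSpace ℝ (Fin d)) :
    hessian (finiteSum f) x = (1 / (n : ℝ)) • ∑ i, hessian (f i) x := by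
  have hg : gradient (finiteSum f) = fun y => (1 / (n : ℝ)) • ∑ i, gradient (f i) y := by
    ext1 y
    have h : HasFDerivAt (finiteSum f) ((1 / (n : ℝ)) • ∑ i, fderiv ℝ (f i) y) y :=
      (HasFDerivAt.fun_sum fun i _ => ((hf i).1 y).hasFDerivAt).const_mul _
    simp [gradient, h.fderiv]
  rw [hessian, hg]
  have h : HasFDerivAt (fun y => ∑ i, gradient (f i) y) (∑ i, hessian (f i) x) x :=
    HasFDerivAt.fun_sum fun i _ => ((hf i).2 x).hasFDerivAt
  exact (h.const_smul (1 / (n : ℝ))).fderiv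

theorem subsampledHessian_uniform {n m : ℕ} [NeZero n]
    (f : Fin n → EuclideanSpace ℝ (Fin d) → ℝ) (s : Fin m → Fin n)
    (x : EuclideanSpace ℝ (Fin d)) :
    subsampledHessian f (fun _ => 1 / (n : ℝ)) s x =
      (1 / (m : ℝ)) • ∑ k, hessian (f (s k)) x := by
  have hn : (n : ℝ) ≠ 0 := Nat.cast_ne_zero.2 (NeZero.ne n)
  rw [subsampledHessian, ← Finset.smul_sum, smul_smul]
  congr 1
  rcases eq_or_ne (m : ℝ) 0 with hm | hm
  · simp [hm]
  · field_simp

end SubsampledNewton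

open MatrixConcentration in
theorem mainTheorem4 {d n m : ℕ} (hd : 0 < d) [NeZero n] (hm : 0 < m)
    (f : Fin n → EuclideanSpace ℝ (Fin d) → ℝ)
    (hf : ∀ i, SubsampledNewton.TwiceDifferentiable (f i))
    (K : Fin n → ℝ) (hK : ∀ i y, ‖SubsampledNewton.hessian (f i) y‖ ≤ K i)
    (Kmax : ℝ) (hKmax : Kmax = Finset.univ.sup' Finset.univ_nonempty K)
    (ε δ : ℝ) (hε₀ : 0 < ε) (hε₁ : ε < 1) (hδ₀ : 0 < δ) (hδ₁ : δ < 1)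
    (hsize : 16 * Kmax ^ 2 / ε ^ 2 * Real.log (2 * (d : ℝ) / δ) ≤ (m : ℝ))
    {Ω : Type*} [MeasurableSpace Ω] (μ : Measure Ω) [IsProbabilityMeasure μ]
    (J : Fin m → Ω → Fin n)
    (hJ : SubsampledNewton.UniformWithReplacement μ J ∨
      SubsampledNewton.UniformWithoutReplacement μ J)
    (x : EuclideanSpace ℝ (Fin d)) :
    1 - δ ≤ μ.real {ω |
      ‖SubsampledNewton.subsampledHessian f (fun _ => 1 / (n : ℝ)) (fun k => J k ω) x
        - SubsampledNewton.hessian (SubsampledNewton.finiteSum f) x‖ ≤ ε} := by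
  have hn : (0 : ℝ) < n := Nat.cast_pos.2 (NeZero.pos n)
  have hm' : (0 : ℝ) < m := Nat.cast_pos.2 hm
  have hd' : (1 : ℝ) ≤ d := Nat.one_le_cast.2 hd
  set H : Fin n → EuclideanSpace ℝ (Fin d) →L[ℝ] EuclideanSpace ℝ (Fin d) :=
    fun i => SubsampledNewton.hessian (f i) x with hH
  set M := (1 / (n : ℝ)) • ∑ i, H i with hM
  have hHK : ∀ i, ‖H i‖ ≤ Kmax := fun i =>
    (hK i x).trans (hKmax ▸ Finset.le_sup' K (Finset.mem_univ i))
  have hK0 : 0 ≤ Kmax := (norm_nonneg _).trans (hHK 0)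
  have hL : ∀ i j, ‖(H i - M) - (H j - M)‖ ≤ 2 * Kmax := fun i j => by
    rw [sub_sub_sub_cancel_right]
    linarith [norm_sub_le (H i) (H j), hHK i, hHK j]
  have hX0 : ∑ i, (H i - M) = 0 := by
    rw [Finset.sum_sub_distrib, Finset.sum_const, Finset.card_univ, Fintype.card_fin,
      ← Nat.cast_smul_eq_nsmul ℝ, hM, smul_smul, mul_one_div_cancel hn.ne', one_smul, sub_self]
  have hXs : ∀ i, ((H i - M : _ →L[ℝ] EuclideanSpace ℝ (Fin d)) :
      EuclideanSpace ℝ (Fin d) →ₗ[ℝ] EuclideanSpace ℝ (Fin d)).IsSymmetric := by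
    intro i
    have hHs : ∀ i, (H i : EuclideanSpace ℝ (Fin d) →ₗ[ℝ] EuclideanSpace ℝ (Fin d)).IsSymmetric :=
      fun i => (hf i).isSymmetric_hessian x
    exact (hHs i).sub ((isSymmetric_sum hHs).smul (by simp))
  have hset : ∀ s : Fin m → Fin n, ‖SubsampledNewton.subsampledHessian f (fun _ => 1 / (n : ℝ)) s x
        - SubsampledNewton.hessian (SubsampledNewton.finiteSum f) x‖ ≤ ε ↔
      ‖∑ k, (H (s k) - M)‖ ≤ m * ε := by
    intro s
    have h : ∑ k, (H (s k) - M) =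
        (m : ℝ) • (SubsampledNewton.subsampledHessian f (fun _ => 1 / (n : ℝ)) s x
        - SubsampledNewton.hessian (SubsampledNewton.finiteSum f) x) := by
      rw [SubsampledNewton.subsampledHessian_uniform, smul_sub, smul_smul,
        mul_one_div_cancel hm'.ne', one_smul, SubsampledNewton.hessian_finiteSum hf,
        Finset.sum_sub_distrib, Finset.sum_const, Finset.card_univ, Fintype.card_fin,
        Nat.cast_smul_eq_nsmul]
    rw [h, norm_smul, Real.norm_of_nonneg hm'.le, mul_le_mul_iff_right₀ hm']
  simp_rw [hset]
  rcases hK0.eq_or_lt with hK0 | hKpos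
  -- If `Kmax = 0`, all the Hessians vanish, and the size condition says nothing about `m`.
  · have : ∀ s : Fin m → Fin n, ‖∑ k, (H (s k) - M)‖ ≤ m * ε := by
      intro s
      have hz : ∀ i, H i = 0 := fun i => norm_le_zero_iff.1 (hK0 ▸ hHK i)
      simp only [hM, hz]
      simp
      positivity
    simp only [this, Set.ofPred_true, probReal_univ]
    linarith
  · refine le_trans ?_ (one_sub_le_measureReal_norm_sum_le hm hJ hXs hX0
      (by positivity : 0 < 2 * Kmax) hL (by positivity : 0 ≤ m * ε))
    rw [finrank_euclideanSpace_fin]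
    have hlog : 0 ≤ Real.log (2 * (d : ℝ) / δ) := by
      refine Real.log_nonneg ?_
      rw [le_div_iff₀ hδ₀]
      linarith
    -- The exponent is `ε² m / (4 Kmax²)`; the size condition gives four times what is needed.
    have hexp : Real.log (2 * (d : ℝ) / δ) ≤ (m * ε) ^ 2 / ((2 * Kmax) ^ 2 * m) := by
      rw [div_mul_eq_mul_div, div_le_iff₀ (by positivity)] at hsize
      rw [le_div_iff₀ (by positivity)]
      nlinarith [mul_le_mul_of_nonneg_left hsize hm'.le,
        mul_nonneg (mul_nonneg hlog (sq_nonneg Kmax)) hm'.le]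
    have h2 : Real.exp (-((m * ε) ^ 2 / ((2 * Kmax) ^ 2 * m))) ≤ δ / (2 * d) := by
      rw [← Real.exp_log (by positivity : 0 < δ / (2 * (d : ℝ))), ← inv_div (2 * (d : ℝ)),
        Real.log_inv]
      exact Real.exp_le_exp.2 (neg_le_neg hexp)
    have h3 := mul_le_mul_of_nonneg_left h2 (by positivity : (0 : ℝ) ≤ 2 * d)
    rw [mul_div_cancel₀ δ (by positivity)] at h3
    linarith
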